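/- All Banach spaces are complex. For Banach spaces $V,W$ let $\mathcal F(V,W)$ be the space of continuous finite-rank operators $V\to W$ with the operator norm, let $\mathcal F(V)=\mathcal F(V,V)$, and let $\mathcal A(V)$ be the algebra of approximable operators, i.e. the operator-norm closure of $\mathcal F(V)$ in $\mathcal B(V)$. A Banach algebra $\mathcal A$ is $K$-amenable if it has an approximate diagonal of bound $K$: a net $(d_\alpha)$ in the completed projective tensor product $\mathcal A\widehat\otimes\mathcal A$ with $\|d_\alpha\|_\wedge\le K$ for all $\alpha$ such that $\pi(d_\alpha)a\to a$ and $a\,d_\alpha-d_\alpha\,a\to 0$ for every $a\in\mathcal A$, where $\pi(a\otimes b)=ab$, $a\,(b\otimes c)=ab\otimes c$ and $(b\otimes c)\,a=b\otimes ca$. For an infinite-dimensional Banach space $Z$ and $T\in\mathcal F(V,W)$ put \[\gamma_Z(T)=\inf\{\|R\|\,\|S\| : RS=T,\ S\in\mathcal F(V,Z),\ R\in\mathcal F(Z,W)\}.\] An infinite-dimensional Banach space $Z$ has the factorization-norm property if $\gamma_Z$ is a norm on $\mathcal F(V,W)$ for every pair of Banach spaces $(V,W)$. A bilinear map $\varphi:E\times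 F\to G$ between normed spaces is $M$-open if for every $z\in G$ there are $x\in E$, $y\in F$ with $\varphi(x,y)=z$ and $\|x\|\,\|y\|\le M\|z\|$. Theorem. Let $X$ be an infinite-dimensional Banach space such that $\mathcal A(X)$ is $K$-amenable, let $P$ be a bounded projection on $X$, and set $Y=\mathrm{rg}\,P$ and $Z=\mathrm{rg}\,(I-P)$. Suppose that both $Y$ and $Z$ have the factorization-norm property. Then there are constants $\kappa\ge 0$ and $M$ with \[\kappa\le 4K^2\,\|P\|\,\|I-P\|\,\max\{\|P\|^4,\|I-P\|^4\},\qquad M\le\kappa^2K^2\,\|P\|\,\|I-P\|,\] such that at least one of the composition maps \[\varphi_Y:\mathcal F(Z,Y)\times\mathcal F(Y,Z)\to\mathcal F(Y),\qquad \varphi_Z:\mathcal F(Y,Z)\times\mathcal F(Z,Y)\to\mathcal F(Z),\qquad (R,S)\mapsto RS,\] is $M$-open. -/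

import Mathlib

open Filter Topology
open scoped TensorProduct

universe u

noncomputable section

/-! ### Finite-rank and approximable operators -/

section FiniteRank

variable (X Y : Type*) [NormedAddCommGroup X] [NormedSpace ℂ X]
  [NormedAddCommGroup Y] [NormedSpace ℂ Y]

/-- The space `F(X, Y)` of continuous finite-rank operators, with the operator norm. -/
def finiteRank : Submodule ℂ (X →L[ℂ] Y) where
  carrier := {T | FiniteDimensional ℂ (LinearMap.range T.toLinearMap)}
  zero_mem' := by
    change FiniteDimensional ℂ (LinearMap.range (0 : X →ₗ[ℂ] Y))
    rw [LinearMap.range_zero]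
    infer_instance
  add_mem' := by
    intro S T hS hT
    change FiniteDimensional ℂ _ at hS hT
    change FiniteDimensional ℂ _
    refine Submodule.finiteDimensional_of_le (S₂ :=
      LinearMap.range S.toLinearMap ⊔ LinearMap.range T.toLinearMap) ?_
    rintro _ ⟨x, rfl⟩
    exact Submodule.add_mem_sup ⟨x, rfl⟩ ⟨x, rfl⟩
  smul_mem' := by
    intro c T hT
    change FiniteDimensional ℂ _ at hT
    change FiniteDimensional ℂ _
    refine Submodule.finiteDimensional_of_le (S₂ := LinearMap.range T.toLinearMap) ?_
    rintro _ ⟨x, rfl⟩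
    exact ⟨c • x, by simp⟩

variable {X Y}

theorem mem_finiteRank {T : X →L[ℂ] Y} :
    T ∈ finiteRank X Y ↔ FiniteDimensional ℂ (LinearMap.range T.toLinearMap) := Iff.rfl

theorem comp_mem_finiteRank {W : Type*} [NormedAddCommGroup W] [NormedSpace ℂ W]
    {R : X →L[ℂ] Y} (hR : R ∈ finiteRank X Y) (S : W →L[ℂ] X) :
    R ∘L S ∈ finiteRank W Y := by
  rw [mem_finiteRank] at hR ⊢
  refine Submodule.finiteDimensional_of_le (S₂ := LinearMap.range R.toLinearMap) ?_
  rintro _ ⟨x, rfl⟩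
  exact ⟨S x, rfl⟩

/-- The product map `F(Z, Y) × F(W, Z) → F(W, Y)`, `(R, S) ↦ R S`, as a bilinear map. -/
def finiteRankComp (W Z Y : Type*) [NormedAddCommGroup W] [NormedSpace ℂ W]
    [NormedAddCommGroup Z] [NormedSpace ℂ Z] [NormedAddCommGroup Y] [NormedSpace ℂ Y] :
    finiteRank Z Y →ₗ[ℂ] finiteRank W Z →ₗ[ℂ] finiteRank W Y :=
  LinearMap.mk₂ ℂ (fun R S => ⟨R.1 ∘L S.1, comp_mem_finiteRank R.2 S.1⟩)
    (fun _ _ _ => by ext; simp) (fun _ _ _ => by ext; simp)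
    (fun _ _ _ => by ext; simp) (fun _ _ _ => by ext; simp)

@[simp]
theorem finiteRankComp_coe (W Z Y : Type*) [NormedAddCommGroup W] [NormedSpace ℂ W]
    [NormedAddCommGroup Z] [NormedSpace ℂ Z] [NormedAddCommGroup Y] [NormedSpace ℂ Y]
    (R : finiteRank Z Y) (S : finiteRank W Z) :
    (finiteRankComp W Z Y R S : W →L[ℂ] Y) = (R : Z →L[ℂ] Y) ∘L (S : W →L[ℂ] Z) := rfl

variable (X)

/-- `F(X)` as a (non-unital) subalgebra of `B(X)`. -/
def finiteRankAlgebra : NonUnitalSubalgebra ℂ (X →L[ℂ] X) where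
  __ := finiteRank X X
  mul_mem' := fun {_ b} ha _ => comp_mem_finiteRank ha b

/-- The algebra `A(X)` of approximable operators: the operator norm closure of `F(X)` in `B(X)`. -/
def approximableAlgebra : NonUnitalSubalgebra ℂ (X →L[ℂ] X) :=
  (finiteRankAlgebra X).topologicalClosure

instance : NormedSpace ℂ (approximableAlgebra X) where
  norm_smul_le c T := norm_smul_le c (T : X →L[ℂ] X)

instance [CompleteSpace X] : CompleteSpace (approximableAlgebra X) :=
  (NonUnitalSubalgebra.isClosed_topologicalClosure (finiteRankAlgebra X)).completeSpace_coe

end FiniteRank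

/-! ### The projective tensor square of a Banach algebra and `K`-amenability -/

section Amenable

variable (A : Type u) [NonUnitalNormedRing A] [NormedSpace ℂ A] [IsScalarTower ℂ A A]
  [SMulCommClass ℂ A A]

/-- The completed projective tensor product of `A` with itself: the completion of the algebraic
tensor product for the projective norm (Mathlib's norm on `PiTensorProduct`). -/
abbrev ProjTensorSq : Type u := UniformSpace.Completion (⨂[ℂ] _ : Fin 2, A)

/-- The product `(a, b) ↦ a b` as a continuous multilinear map of two variables. -/
def mulMultilinear : ContinuousMultilinearMap ℂ (fun _ : Fin 2 => A) A :=
  MultilinearMap.mkContinuous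
    { toFun := fun m => m 0 * m 1
      map_update_add' := by
        intro _ m i x y
        fin_cases i <;> simp [Function.update, add_mul, mul_add]
      map_update_smul' := by
        intro _ m i c x
        fin_cases i <;> simp [Function.update, smul_mul_assoc, mul_smul_comm] }
    1 (fun m => by simpa using norm_mul_le (m 0) (m 1))

/-- The continuous linear map `π` on the completed projective tensor square with
`π (a ⊗ b) = a b`. -/
def projMul [CompleteSpace A] : ProjTensorSq A →L[ℂ] A :=
  (PiTensorProduct.liftIsometry ℂ (fun _ : Fin 2 => A) A (mulMultilinear A)).extend
    (UniformSpace.Completion.toComplL (𝕜 := ℂ))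

variable {A}

/-- The continuous linear map on the completed projective tensor square with
`b ⊗ c ↦ f b ⊗ g c`. -/
def projMap (f g : A →L[ℂ] A) : ProjTensorSq A →L[ℂ] ProjTensorSq A :=
  ((UniformSpace.Completion.toComplL (𝕜 := ℂ)) ∘L
    PiTensorProduct.mapL (E := fun _ : Fin 2 => A) (E' := fun _ : Fin 2 => A) ![f, g]).extend
      (UniformSpace.Completion.toComplL (𝕜 := ℂ))

/-- The left module action `a · (b ⊗ c) = a b ⊗ c`. -/
def projLeft (a : A) : ProjTensorSq A →L[ℂ] ProjTensorSq A :=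
  projMap (ContinuousLinearMap.mul ℂ A a) (ContinuousLinearMap.id ℂ A)

/-- The right module action `(b ⊗ c) · a = b ⊗ c a`. -/
def projRight (a : A) : ProjTensorSq A →L[ℂ] ProjTensorSq A :=
  projMap (ContinuousLinearMap.id ℂ A) ((ContinuousLinearMap.mul ℂ A).flip a)

theorem projMul_coe [CompleteSpace A] (t : ⨂[ℂ] _ : Fin 2, A) :
    projMul A (t : ProjTensorSq A) =
      PiTensorProduct.liftIsometry ℂ (fun _ : Fin 2 => A) A (mulMultilinear A) t :=
  ContinuousLinearMap.extend_eq _ UniformSpace.Completion.denseRange_coe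
    (UniformSpace.Completion.isUniformInducing_coe _) t

theorem projMul_tprod [CompleteSpace A] (m : Fin 2 → A) :
    projMul A ((PiTensorProduct.tprod ℂ m : ⨂[ℂ] _ : Fin 2, A) : ProjTensorSq A) = m 0 * m 1 := by
  rw [projMul_coe]
  simp [mulMultilinear]

theorem projMap_coe (f g : A →L[ℂ] A) (t : ⨂[ℂ] _ : Fin 2, A) :
    projMap f g (t : ProjTensorSq A) =
      ((PiTensorProduct.mapL (E := fun _ : Fin 2 => A) (E' := fun _ : Fin 2 => A) ![f, g] t :
        ⨂[ℂ] _ : Fin 2, A) : ProjTensorSq A) :=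
  ContinuousLinearMap.extend_eq _ UniformSpace.Completion.denseRange_coe
    (UniformSpace.Completion.isUniformInducing_coe _) t

theorem projMap_tprod (f g : A →L[ℂ] A) (m : Fin 2 → A) :
    projMap f g ((PiTensorProduct.tprod ℂ m : ⨂[ℂ] _ : Fin 2, A) : ProjTensorSq A) =
      ((PiTensorProduct.tprod ℂ ![f (m 0), g (m 1)] : ⨂[ℂ] _ : Fin 2, A) : ProjTensorSq A) := by
  rw [projMap_coe]
  congr 1
  simp only [PiTensorProduct.mapL_apply, PiTensorProduct.map_tprod]
  congr 1
  ext i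
  fin_cases i <;> rfl

variable (A)

/-- `A` is `K`-amenable: there is an approximate diagonal of bound `K`, i.e. a net `(d i)` in the
completed projective tensor square of `A` with `‖d i‖ ≤ K`, `π (d i) a → a` and
`a · d i - d i · a → 0` for every `a` in `A`. -/
def IsKAmenable [CompleteSpace A] (K : ℝ) : Prop :=
  ∃ (ι : Type u) (_ : Preorder ι) (_ : IsDirectedOrder ι) (_ : Nonempty ι)
    (d : ι → ProjTensorSq A),
    (∀ i, ‖d i‖ ≤ K) ∧
    (∀ a : A, Tendsto (fun i => projMul A (d i) * a) atTop (𝓝 a)) ∧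
    (∀ a : A, Tendsto (fun i => projLeft a (d i) - projRight a (d i)) atTop (𝓝 0))

end Amenable

/-! ### The factorization-norm property and open bilinear maps -/

/-- `N` is a norm on the complex vector space `V`. -/
structure IsNormOn {V : Type*} [AddCommGroup V] [Module ℂ V] (N : V → ℝ) : Prop where
  nonneg : ∀ v, 0 ≤ N v
  eq_zero_iff : ∀ v, N v = 0 ↔ v = 0
  smul : ∀ (c : ℂ) v, N (c • v) = ‖c‖ * N v
  add_le : ∀ v w, N (v + w) ≤ N v + N w

/-- `γ_Z(T)`: the infimum of `‖R‖ ‖S‖` over the factorizations `T = R S` with `S ∈ F(X, Z)` and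
`R ∈ F(Z, Y)`. (When `Z` is infinite dimensional such factorizations exist for every `T` in
`F(X, Y)`.) -/
def gammaNorm (Z : Type*) [NormedAddCommGroup Z] [NormedSpace ℂ Z]
    {X Y : Type*} [NormedAddCommGroup X] [NormedSpace ℂ X]
    [NormedAddCommGroup Y] [NormedSpace ℂ Y] (T : finiteRank X Y) : ℝ :=
  sInf {r : ℝ | ∃ (R : finiteRank Z Y) (S : finiteRank X Z),
    finiteRankComp X Z Y R S = T ∧ r = ‖R‖ * ‖S‖}

/-- An infinite-dimensional space `Z` has the factorization-norm property if `γ_Z` is a norm on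
`F(X, Y)` for every pair of Banach spaces `(X, Y)`. -/
structure HasFactorizationNormProperty (Z : Type u) [NormedAddCommGroup Z] [NormedSpace ℂ Z] :
    Prop where
  infinite_dimensional : ¬ FiniteDimensional ℂ Z
  isNormOn : ∀ (X Y : Type u) [NormedAddCommGroup X] [NormedSpace ℂ X] [CompleteSpace X]
    [NormedAddCommGroup Y] [NormedSpace ℂ Y] [CompleteSpace Y],
    IsNormOn (fun T : finiteRank X Y => gammaNorm Z T)

/-- A bilinear map `φ : E × F → G` is `M`-open if every `z` in `G` is of the form `φ(x, y)` with
`‖x‖ ‖y‖ ≤ M ‖z‖`. -/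
def IsMOpen {E F G : Type*} [NormedAddCommGroup E] [NormedSpace ℂ E]
    [NormedAddCommGroup F] [NormedSpace ℂ F] [NormedAddCommGroup G] [NormedSpace ℂ G]
    (φ : E →ₗ[ℂ] F →ₗ[ℂ] G) (M : ℝ) : Prop :=
  ∀ z : G, ∃ (x : E) (y : F), φ x y = z ∧ ‖x‖ * ‖y‖ ≤ M * ‖z‖

/-- The range of a bounded operator, as a subspace. -/
abbrev rg {X : Type*} [NormedAddCommGroup X] [NormedSpace ℂ X] (P : X →L[ℂ] X) :
    Submodule ℂ X := LinearMap.range P.toLinearMap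

end

/-! Write `Q = I - P`. An approximate diagonal `d` turns a bounded operator `B` into the operator
`Φ_B(d)` obtained from `a ⊗ b ↦ a B b`. Since `a · d - d · a → 0`, these operators asymptotically
commute with rank one operators, so composed with a functional on the left they become scalar
(`tendsto_comp_sandwichMap`). Along an ultrafilter the scalar for `P` converges to some `μ`; because
`Φ_P(d) + Φ_Q(d) = π(d)` acts asymptotically as the identity, the scalar for `Q` converges to `1 -
μ`. One of the two has modulus at least `1/2`.

Suppose `|μ| ≥ 1/2` and let `T ∈ F(Z)`. Then `μ T` is close to the compression to `Z` of `∑ T a P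
b`, and each summand factors through `Y = rg P`. Since `γ_Y` is a norm, the costs add up and give
`|μ| γ_Y(T) ≤ K ‖P‖ ‖Q‖ ‖T‖` (`norm_mul_gammaNorm_le`); the error is a finite sum of small rank one
operators, which is small for `γ_Y` too. Hence `γ_Y(T) ≤ 2 K ‖P‖ ‖Q‖ ‖T‖`, strictly below the
admissible bound when `T ≠ 0` because `K`, `‖P‖`, `‖Q‖` are at least `1`, and a factorization of the
required cost exists. The other case exchanges `P` and `Q`. -/

noncomputable section Sandwich

/-! ### Linear maps on the completed projective tensor square -/

section ProjTensorSq

variable {A : Type u} [NonUnitalNormedRing A] [NormedSpace ℂ A]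
  {G : Type*} [NormedAddCommGroup G] [NormedSpace ℂ G]

/-- The continuous linear map on the completed projective tensor square induced by a continuous
bilinear map. -/
def projLift [CompleteSpace G] (f : ContinuousMultilinearMap ℂ (fun _ : Fin 2 => A) G) :
    ProjTensorSq A →L[ℂ] G :=
  (PiTensorProduct.liftIsometry ℂ (fun _ : Fin 2 => A) G f).extend
    (UniformSpace.Completion.toComplL (𝕜 := ℂ))

theorem projLift_coe [CompleteSpace G] (f : ContinuousMultilinearMap ℂ (fun _ : Fin 2 => A) G)
    (t : ⨂[ℂ] _ : Fin 2, A) :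
    projLift f (t : ProjTensorSq A) = PiTensorProduct.lift f.toMultilinearMap t :=
  (ContinuousLinearMap.extend_eq _ UniformSpace.Completion.denseRange_coe
    (UniformSpace.Completion.isUniformInducing_coe _) t).trans
      (PiTensorProduct.liftIsometry_apply_apply f t)

theorem norm_projLift_le [CompleteSpace G] (f : ContinuousMultilinearMap ℂ (fun _ : Fin 2 => A) G)
    (d : ProjTensorSq A) : ‖projLift f d‖ ≤ ‖f‖ * ‖d‖ := by
  induction d using UniformSpace.Completion.induction_on with
  | hp => exact isClosed_le (projLift f).continuous.norm (continuous_const.mul continuous_norm)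
  | ih t =>
    rw [projLift_coe, UniformSpace.Completion.norm_coe]
    exact PiTensorProduct.norm_eval_le_projectiveSeminorm f t

theorem exists_norm_projLift_le [CompleteSpace G]
    (f : ContinuousMultilinearMap ℂ (fun _ : Fin 2 => A) G) (K : ℝ) :
    ∃ C : ℝ, ∀ d : ProjTensorSq A, ‖d‖ ≤ K → ‖projLift f d‖ ≤ C :=
  ⟨‖f‖ * K, fun d hd =>
    (norm_projLift_le f d).trans (mul_le_mul_of_nonneg_left hd (norm_nonneg f))⟩

/-- Continuous linear maps on the completed projective tensor square are determined by their
values on elementary tensors. -/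
theorem ProjTensorSq.clm_ext {f g : ProjTensorSq A →L[ℂ] G}
    (h : ∀ m : Fin 2 → A,
      f ((PiTensorProduct.tprod ℂ m : ⨂[ℂ] _ : Fin 2, A) : ProjTensorSq A) =
      g ((PiTensorProduct.tprod ℂ m : ⨂[ℂ] _ : Fin 2, A) : ProjTensorSq A)) : f = g := by
  ext d
  induction d using UniformSpace.Completion.induction_on with
  | hp => exact isClosed_eq f.continuous g.continuous
  | ih t =>
    induction t using PiTensorProduct.induction_on with
    | smul_tprod c m => simp only [UniformSpace.Completion.coe_smul, map_smul, h]
    | add x y hx hy => simp only [UniformSpace.Completion.coe_add, map_add, hx, hy]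

/-- The algebraic tensor square meets every nonempty open subset of its completion, in an element
with a prescribed bound on the projective norm of a representation. -/
theorem ProjTensorSq.exists_lift_mem_open {U : Set (ProjTensorSq A)} (hU : IsOpen U) {d : ProjTensorSq A} (hd : d ∈ U) {r : ℝ}
    (hr : ‖d‖ < r) :
    ∃ (t : ⨂[ℂ] _ : Fin 2, A) (p : PiTensorProduct.lifts t),
      (t : ProjTensorSq A) ∈ U ∧ PiTensorProduct.projectiveSeminormAux p.1 < r := by
  obtain ⟨t, htU, ht⟩ := UniformSpace.Completion.denseRange_coe.exists_mem_open
    (hU.inter (isOpen_lt continuous_norm continuous_const)) ⟨d, hd, hr⟩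
  rw [Set.mem_ofPred_eq, UniformSpace.Completion.norm_coe, PiTensorProduct.norm_def] at ht
  obtain ⟨p, hp⟩ := exists_lt_of_ciInf_lt ht
  exact ⟨t, p, htU, hp⟩

end ProjTensorSq

/-! ### Sandwich maps `a ⊗ b ↦ a B b` -/

variable {X : Type u} [NormedAddCommGroup X] [NormedSpace ℂ X]

/-- The bilinear map `(a, b) ↦ a B b` on `A(X)`, as a continuous multilinear map. -/
def sandwichMultilinear (B : X →L[ℂ] X) :
    ContinuousMultilinearMap ℂ (fun _ : Fin 2 => approximableAlgebra X) (X →L[ℂ] X) :=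
  MultilinearMap.mkContinuous
    { toFun := fun m => (m 0 : X →L[ℂ] X) * (B * (m 1 : X →L[ℂ] X))
      map_update_add' := by
        intro _ m i x y
        fin_cases i <;> simp [Function.update, add_mul, mul_add]
      map_update_smul' := by
        intro _ m i c x
        fin_cases i <;> simp [Function.update] }
    ‖B‖ (fun m => by
      refine (norm_mul_le _ _).trans ?_
      refine (mul_le_mul_of_nonneg_left (norm_mul_le _ _) (norm_nonneg _)).trans ?_
      simp only [Fin.prod_univ_two, AddSubgroupClass.coe_norm]
      exact le_of_eq (by ring))

variable [CompleteSpace X]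

/-- The continuous linear map on the completed projective tensor square of `A(X)` with
`a ⊗ b ↦ a B b`. -/
def sandwichMap (B : X →L[ℂ] X) : ProjTensorSq (approximableAlgebra X) →L[ℂ] (X →L[ℂ] X) :=
  projLift (sandwichMultilinear B)

theorem sandwichMap_tprod (B : X →L[ℂ] X) (m : Fin 2 → approximableAlgebra X) :
    sandwichMap B ((PiTensorProduct.tprod ℂ m : ⨂[ℂ] _ : Fin 2, approximableAlgebra X) :
      ProjTensorSq (approximableAlgebra X)) = (m 0 : X →L[ℂ] X) * (B * (m 1 : X →L[ℂ] X)) :=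
  (projLift_coe _ _).trans (PiTensorProduct.lift.tprod m)

theorem sandwichMap_projLeft (B : X →L[ℂ] X) (a : approximableAlgebra X)
    (d : ProjTensorSq (approximableAlgebra X)) :
    sandwichMap B (projLeft a d) = (a : X →L[ℂ] X) * sandwichMap B d := by
  have : sandwichMap B ∘L projLeft a =
      ContinuousLinearMap.mul ℂ (X →L[ℂ] X) (a : X →L[ℂ] X) ∘L sandwichMap B :=
    ProjTensorSq.clm_ext fun m => by
      simp [projLeft, projMap_tprod, sandwichMap_tprod, mul_assoc]
  exact DFunLike.congr_fun this d

theorem sandwichMap_projRight (B : X →L[ℂ] X) (a : approximableAlgebra X)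
    (d : ProjTensorSq (approximableAlgebra X)) :
    sandwichMap B (projRight a d) = sandwichMap B d * (a : X →L[ℂ] X) := by
  have : sandwichMap B ∘L projRight a =
      (ContinuousLinearMap.mul ℂ (X →L[ℂ] X)).flip (a : X →L[ℂ] X) ∘L sandwichMap B :=
    ProjTensorSq.clm_ext fun m => by
      simp [projRight, projMap_tprod, sandwichMap_tprod, mul_assoc]
  exact DFunLike.congr_fun this d

/-- On elementary tensors `a P b + a (I - P) b = a b`. This is what makes the two limit scalars add
up to `1`. -/
theorem sandwichMap_add_compl (P : X →L[ℂ] X) (d : ProjTensorSq (approximableAlgebra X)) :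
    sandwichMap P d + sandwichMap (ContinuousLinearMap.id ℂ X - P) d =
      (projMul (approximableAlgebra X) d : approximableAlgebra X) := by
  have : sandwichMap P + sandwichMap (ContinuousLinearMap.id ℂ X - P) =
      (NonUnitalSubalgebra.toSubmodule (approximableAlgebra X)).subtypeL ∘L
        projMul (approximableAlgebra X) :=
    ProjTensorSq.clm_ext fun m => by
      rw [add_apply, ContinuousLinearMap.comp_apply, projMul_tprod, sandwichMap_tprod, sandwichMap_tprod]
      change (m 0 : X →L[ℂ] X) * (P * (m 1 : X →L[ℂ] X)) +
        (m 0 : X →L[ℂ] X) * ((1 - P) * (m 1 : X →L[ℂ] X)) =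
        (m 0 : X →L[ℂ] X) * (m 1 : X →L[ℂ] X)
      rw [← mul_add, ← add_mul, add_sub_cancel, one_mul]
  exact DFunLike.congr_fun this d

/-! ### Replacing tensors by finite lists of finite rank pairs -/

/-- The cost `∑ ‖a‖ ‖b‖` of a list of pairs. -/
def pairCost {E : Type*} [Norm E] (l : List (E × E)) : ℝ :=
  (l.map fun p => ‖p.1‖ * ‖p.2‖).sum

/-- The sum `∑ a B b` over a list of pairs. -/
def pairSandwich (B : X →L[ℂ] X) (l : List ((X →L[ℂ] X) × (X →L[ℂ] X))) : X →L[ℂ] X :=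
  (l.map fun p => p.1 * (B * p.2)).sum

/-- A representation of a nearby algebraic tensor serves as the list, with scalar coefficients
absorbed into the left factors. One list has to serve both `P` and `Q`: the proof of `1 ≤ K` adds
the two sandwiches. -/
theorem exists_list_of_projTensorSq (P Q : X →L[ℂ] X) (d : ProjTensorSq (approximableAlgebra X))
    {δ : ℝ} (hδ : 0 < δ) :
    ∃ l : List ((X →L[ℂ] X) × (X →L[ℂ] X)),
      (∀ p ∈ l, p.1 ∈ approximableAlgebra X ∧ p.2 ∈ approximableAlgebra X) ∧
      pairCost l < ‖d‖ + δ ∧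
      ‖sandwichMap P d - pairSandwich P l‖ < δ ∧ ‖sandwichMap Q d - pairSandwich Q l‖ < δ := by
  have hopen : IsOpen {e : ProjTensorSq (approximableAlgebra X) |
      ‖sandwichMap P d - sandwichMap P e‖ < δ ∧ ‖sandwichMap Q d - sandwichMap Q e‖ < δ} :=
    (isOpen_lt (continuous_const.sub (sandwichMap P).continuous).norm continuous_const).and
      (isOpen_lt (continuous_const.sub (sandwichMap Q).continuous).norm continuous_const)
  obtain ⟨t, ⟨p, hp⟩, ⟨ht2, ht3⟩, hlt⟩ := ProjTensorSq.exists_lift_mem_open hopen (d := d)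
    (by simpa using hδ) (lt_add_of_pos_right ‖d‖ hδ)
  rw [PiTensorProduct.mem_lifts_iff] at hp
  let l : List ((X →L[ℂ] X) × (X →L[ℂ] X)) :=
    p.toList.map fun q => (q.1 • (q.2 0 : X →L[ℂ] X), (q.2 1 : X →L[ℂ] X))
  have hs (B : X →L[ℂ] X) :
      sandwichMap B (t : ProjTensorSq (approximableAlgebra X)) = pairSandwich B l := by
    rw [← hp, sandwichMap, projLift_coe, map_list_sum, pairSandwich, List.map_map, List.map_map]
    congr 1
    refine List.map_congr_left fun q _ => ?_
    simp [sandwichMultilinear]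
  refine ⟨l, ?_, ?_, ?_, ?_⟩
  · intro q hq
    obtain ⟨r, -, rfl⟩ := List.mem_map.1 hq
    exact ⟨(r.1 • r.2 0).2, (r.2 1).2⟩
  · refine lt_of_eq_of_lt ?_ hlt
    rw [pairCost, PiTensorProduct.projectiveSeminormAux, List.map_map]
    congr 1
    refine List.map_congr_left fun q _ => ?_
    rw [Function.comp_apply, norm_smul, Fin.prod_univ_two, mul_assoc]
    rfl
  · rwa [← hs]
  · rwa [← hs]

-- The factorizations defining `γ` use finite rank factors, so approximable entries are replaced
-- pair by pair, spending half of the remaining tolerance on each.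
omit [CompleteSpace X] in
theorem exists_finiteRank_list (P Q : X →L[ℂ] X) (l : List ((X →L[ℂ] X) × (X →L[ℂ] X)))
    (hl : ∀ p ∈ l, p.1 ∈ approximableAlgebra X ∧ p.2 ∈ approximableAlgebra X)
    {δ : ℝ} (hδ : 0 < δ) :
    ∃ l' : List ((X →L[ℂ] X) × (X →L[ℂ] X)),
      (∀ p ∈ l', p.1 ∈ finiteRank X X ∧ p.2 ∈ finiteRank X X) ∧
      pairCost l' < pairCost l + δ ∧
      ‖pairSandwich P l - pairSandwich P l'‖ < δ ∧
      ‖pairSandwich Q l - pairSandwich Q l'‖ < δ := by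
  induction l generalizing δ with
  | nil => exact ⟨[], by simp, by simpa using hδ, by simpa using hδ, by simpa using hδ⟩
  | cons p l ih =>
    obtain ⟨l', h1, h2, h3, h4⟩ :=
      ih (fun q hq => hl q (List.mem_cons_of_mem _ hq)) (half_pos hδ)
    obtain ⟨hp1, hp2⟩ := hl p List.mem_cons_self
    obtain ⟨a, ha, hat⟩ := mem_closure_iff_seq_limit.1
      (show p.1 ∈ closure (finiteRank X X : Set (X →L[ℂ] X)) from hp1)
    obtain ⟨b, hb, hbt⟩ := mem_closure_iff_seq_limit.1
      (show p.2 ∈ closure (finiteRank X X : Set (X →L[ℂ] X)) from hp2)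
    have e1 : ∀ᶠ n in atTop, ‖a n‖ * ‖b n‖ < ‖p.1‖ * ‖p.2‖ + δ / 2 :=
      (hat.norm.mul hbt.norm).eventually_lt_const (by linarith)
    have e2 (B : X →L[ℂ] X) : ∀ᶠ n in atTop, ‖p.1 * (B * p.2) - a n * (B * b n)‖ < δ / 2 := by
      have : Tendsto (fun n => ‖p.1 * (B * p.2) - a n * (B * b n)‖) atTop
          (𝓝 ‖p.1 * (B * p.2) - p.1 * (B * p.2)‖) :=
        (tendsto_const_nhds.sub (hat.mul (tendsto_const_nhds.mul hbt))).norm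
      exact this.eventually_lt_const (by simpa using hδ)
    obtain ⟨n, hn1, hn2, hn3⟩ := (e1.and ((e2 P).and (e2 Q))).exists
    have key (B : X →L[ℂ] X) (hn : ‖p.1 * (B * p.2) - a n * (B * b n)‖ < δ / 2)
        (hB : ‖pairSandwich B l - pairSandwich B l'‖ < δ / 2) :
        ‖pairSandwich B (p :: l) - pairSandwich B ((a n, b n) :: l')‖ < δ := by
      have : pairSandwich B (p :: l) - pairSandwich B ((a n, b n) :: l') =
          (p.1 * (B * p.2) - a n * (B * b n)) + (pairSandwich B l - pairSandwich B l') := by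
        simp only [pairSandwich, List.map_cons, List.sum_cons]
        abel
      rw [this]
      exact (norm_add_le _ _).trans_lt (by linarith)
    refine ⟨(a n, b n) :: l', ?_, ?_, key P hn2 h3, key Q hn3 h4⟩
    · intro q hq
      rcases List.mem_cons.1 hq with rfl | hq
      · exact ⟨ha n, hb n⟩
      · exact h1 q hq
    · simp only [pairCost, List.map_cons, List.sum_cons] at h2 ⊢
      linarith

theorem exists_finiteRank_list_of_projTensorSq (P Q : X →L[ℂ] X)
    (d : ProjTensorSq (approximableAlgebra X)) {δ : ℝ} (hδ : 0 < δ) :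
    ∃ l : List ((X →L[ℂ] X) × (X →L[ℂ] X)),
      (∀ p ∈ l, p.1 ∈ finiteRank X X ∧ p.2 ∈ finiteRank X X) ∧
      pairCost l < ‖d‖ + δ ∧
      ‖sandwichMap P d - pairSandwich P l‖ < δ ∧ ‖sandwichMap Q d - pairSandwich Q l‖ < δ := by
  obtain ⟨l, h1, h2, h3, h4⟩ := exists_list_of_projTensorSq P Q d (half_pos hδ)
  obtain ⟨l', h1', h2', h3', h4'⟩ := exists_finiteRank_list P Q l h1 (half_pos hδ)
  refine ⟨l', h1', by linarith, ?_, ?_⟩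
  · exact (norm_sub_le_norm_sub_add_norm_sub _ _ _).trans_lt (add_halves δ ▸ add_lt_add h3 h3')
  · exact (norm_sub_le_norm_sub_add_norm_sub _ _ _).trans_lt (add_halves δ ▸ add_lt_add h4 h4')

end Sandwich

/-! ### Limits of sandwiched operators are scalar -/

noncomputable section Scalar

variable {X : Type u} [NormedAddCommGroup X] [NormedSpace ℂ X]

theorem smulRight_mem_finiteRank {Y : Type*} [NormedAddCommGroup Y] [NormedSpace ℂ Y]
    (φ : X →L[ℂ] ℂ) (y : Y) : φ.smulRight y ∈ finiteRank X Y := by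
  rw [mem_finiteRank]
  refine Submodule.finiteDimensional_of_le (S₂ := Submodule.span ℂ {y}) ?_
  rintro _ ⟨x, rfl⟩
  exact Submodule.smul_mem _ _ (Submodule.mem_span_singleton_self y)

theorem finiteRank_le_approximable {T : X →L[ℂ] X} (hT : T ∈ finiteRank X X) :
    T ∈ approximableAlgebra X :=
  subset_closure (s := (finiteRank X X : Set (X →L[ℂ] X))) hT

variable [CompleteSpace X]

/-- Sandwiching a bounded operator `B` by an approximate diagonal produces operators whose
adjoints become asymptotically scalar. -/
theorem tendsto_comp_sandwichMap {ι : Type*} {l : Filter ι}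
    {d : ι → ProjTensorSq (approximableAlgebra X)}
    (hd : ∀ a, Tendsto (fun i => projLeft a (d i) - projRight a (d i)) l (𝓝 0))
    {x₀ : X} {φ₀ : X →L[ℂ] ℂ} (h₀ : φ₀ x₀ = 1) (B : X →L[ℂ] X) (φ : X →L[ℂ] ℂ) :
    Tendsto (fun i => φ ∘L sandwichMap B (d i) - φ₀ (sandwichMap B (d i) x₀) • φ) l (𝓝 0) := by
  -- Test against `a = φ(·) x₀` and write `S = Φ_B(d i)`: applying `φ₀` on the left of `a S - S a`
  -- gives `φ ∘ S - φ₀(S x₀) φ`, as `φ₀ x₀ = 1`.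
  have h := ((sandwichMap B).continuous.tendsto 0).comp
    (hd ⟨_, finiteRank_le_approximable (smulRight_mem_finiteRank φ x₀)⟩)
  have h' := ((ContinuousLinearMap.compL ℂ X X ℂ φ₀).continuous.tendsto _).comp h
  simp only [map_zero] at h'
  refine h'.congr fun i => ?_
  ext x
  simp [sandwichMap_projLeft, sandwichMap_projRight, h₀, mul_comm]

theorem tendsto_comp_sandwichMap_of_tendsto {ι : Type*} {l : Filter ι}
    {d : ι → ProjTensorSq (approximableAlgebra X)}
    (hd : ∀ a, Tendsto (fun i => projLeft a (d i) - projRight a (d i)) l (𝓝 0))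
    {x₀ : X} {φ₀ : X →L[ℂ] ℂ} (h₀ : φ₀ x₀ = 1) {B : X →L[ℂ] X} {β : ℂ}
    (hβ : Tendsto (fun i => φ₀ (sandwichMap B (d i) x₀)) l (𝓝 β)) (φ : X →L[ℂ] ℂ) :
    Tendsto (fun i => φ ∘L sandwichMap B (d i) - β • φ) l (𝓝 0) := by
  have h := (tendsto_comp_sandwichMap hd h₀ B φ).add ((hβ.sub_const β).smul_const φ)
  rw [sub_self, zero_add, show (0 : ℂ) • φ = 0 from zero_smul ℂ φ] at h
  refine h.congr fun i => ?_
  ext x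
  simp [sub_mul]

/-- Test `π(d i) a → a` on `a = φ₀(·) x₀`, evaluate at `x₀` and apply `φ₀`. -/
theorem tendsto_sandwichMap_add_compl {ι : Type*} {l : Filter ι}
    {d : ι → ProjTensorSq (approximableAlgebra X)}
    (hd : ∀ a, Tendsto (fun i => projMul (approximableAlgebra X) (d i) * a) l (𝓝 a))
    {x₀ : X} {φ₀ : X →L[ℂ] ℂ} (h₀ : φ₀ x₀ = 1) (P : X →L[ℂ] X) :
    Tendsto (fun i => φ₀ (sandwichMap P (d i) x₀) +
      φ₀ (sandwichMap (ContinuousLinearMap.id ℂ X - P) (d i) x₀)) l (𝓝 1) := by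
  have h := ((NonUnitalSubalgebra.toSubmodule (approximableAlgebra X)).subtypeL.continuous.tendsto
    _).comp (hd ⟨_, finiteRank_le_approximable (smulRight_mem_finiteRank φ₀ x₀)⟩)
  have h' := ((φ₀ ∘L ContinuousLinearMap.apply ℂ X x₀).continuous.tendsto _).comp h
  have e : (φ₀ ∘L ContinuousLinearMap.apply ℂ X x₀) (φ₀.smulRight x₀) = 1 := by simp [h₀]
  change Tendsto _ _ (𝓝 ((φ₀ ∘L ContinuousLinearMap.apply ℂ X x₀) (φ₀.smulRight x₀))) at h'
  rw [e] at h'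
  refine h'.congr fun i => ?_
  change φ₀ ((projMul (approximableAlgebra X) (d i) : X →L[ℂ] X) (φ₀ x₀ • x₀)) = _
  rw [← sandwichMap_add_compl P, h₀, one_smul, add_apply, map_add]

/-- The scalars stay in a closed disc because `d` is bounded, and the disc is compact. -/
theorem exists_tendsto_sandwichMap {ι : Type*} (U : Ultrafilter ι) {K : ℝ}
    {d : ι → ProjTensorSq (approximableAlgebra X)} (hdK : ∀ i, ‖d i‖ ≤ K)
    (B : X →L[ℂ] X) (x₀ : X) (φ₀ : X →L[ℂ] ℂ) :
    ∃ μ : ℂ, Tendsto (fun i => φ₀ (sandwichMap B (d i) x₀)) U (𝓝 μ) := by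
  obtain ⟨C, hC⟩ := exists_norm_projLift_le (A := approximableAlgebra X) (G := X →L[ℂ] X)
    (sandwichMultilinear B) K
  have hb (i : ι) : φ₀ (sandwichMap B (d i) x₀) ∈
      Metric.closedBall (0 : ℂ) (‖φ₀‖ * (C * ‖x₀‖)) := by
    rw [mem_closedBall_zero_iff]
    exact φ₀.le_opNorm_of_le ((sandwichMap B (d i)).le_of_opNorm_le (hC _ (hdK i)) x₀)
  obtain ⟨μ, -, hμ⟩ := (isCompact_closedBall (0 : ℂ) (‖φ₀‖ * (C * ‖x₀‖))).ultrafilter_le_nhds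
    (U.map fun i => φ₀ (sandwichMap B (d i) x₀))
    (tendsto_principal.2 (Eventually.of_forall hb))
  exact ⟨μ, hμ⟩

/-- `μ` is the ultrafilter limit, hence independent of `s` and `ε`; finitely many eventual estimates
then hold at a common index. -/
theorem exists_scalar_projTensorSq {ι : Type*} (U : Ultrafilter ι) {K : ℝ}
    {d : ι → ProjTensorSq (approximableAlgebra X)} (hdK : ∀ i, ‖d i‖ ≤ K)
    (hdm : ∀ a, Tendsto (fun i => projMul (approximableAlgebra X) (d i) * a) U (𝓝 a))
    (hdc : ∀ a, Tendsto (fun i => projLeft a (d i) - projRight a (d i)) U (𝓝 0))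
    (P : X →L[ℂ] X) {x₀ : X} {φ₀ : X →L[ℂ] ℂ} (h₀ : φ₀ x₀ = 1) :
    ∃ μ : ℂ, ∀ (s : Finset (X →L[ℂ] ℂ)) (ε : ℝ), 0 < ε →
      ∃ d : ProjTensorSq (approximableAlgebra X), ‖d‖ ≤ K ∧
        ∀ φ ∈ s, ‖φ ∘L sandwichMap P d - μ • φ‖ < ε ∧
          ‖φ ∘L sandwichMap (ContinuousLinearMap.id ℂ X - P) d - (1 - μ) • φ‖ < ε := by
  obtain ⟨μ, hμ⟩ := exists_tendsto_sandwichMap U hdK P x₀ φ₀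
  have hν : Tendsto (fun i => φ₀ (sandwichMap (ContinuousLinearMap.id ℂ X - P) (d i) x₀)) U
      (𝓝 (1 - μ)) :=
    ((tendsto_sandwichMap_add_compl hdm h₀ P).sub hμ).congr fun i => by
      rw [add_sub_cancel_left]
  refine ⟨μ, fun s ε hε => ?_⟩
  have hlim {B : X →L[ℂ] X} {β : ℂ}
      (hβ : Tendsto (fun i => φ₀ (sandwichMap B (d i) x₀)) U (𝓝 β)) (φ : X →L[ℂ] ℂ) :
      ∀ᶠ i in (U : Filter ι), ‖φ ∘L sandwichMap B (d i) - β • φ‖ < ε :=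
    (tendsto_comp_sandwichMap_of_tendsto hdc h₀ hβ φ).norm.eventually_lt_const
      (by rwa [norm_zero])
  obtain ⟨i, hi⟩ := ((Filter.eventually_all_finset s).2 fun φ _ =>
    (hlim hμ φ).and (hlim hν φ)).exists
  exact ⟨d i, hdK i, hi⟩

theorem exists_scalar_list {K : ℝ} (hK : IsKAmenable (approximableAlgebra X) K)
    (P : X →L[ℂ] X) {x₀ : X} {φ₀ : X →L[ℂ] ℂ} (h₀ : φ₀ x₀ = 1) :
    ∃ μ : ℂ, ∀ (s : Finset (X →L[ℂ] ℂ)) (ε : ℝ), 0 < ε →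
      ∃ l : List ((X →L[ℂ] X) × (X →L[ℂ] X)),
        (∀ p ∈ l, p.1 ∈ finiteRank X X ∧ p.2 ∈ finiteRank X X) ∧ pairCost l < K + ε ∧
        ∀ φ ∈ s, ‖φ ∘L pairSandwich P l - μ • φ‖ < ε ∧
          ‖φ ∘L pairSandwich (ContinuousLinearMap.id ℂ X - P) l - (1 - μ) • φ‖ < ε := by
  obtain ⟨ι, _, _, _, d, hdK, hdm, hdc⟩ := hK
  have hU : ((Ultrafilter.of (atTop : Filter ι) : Ultrafilter ι) : Filter ι) ≤ atTop :=
    Ultrafilter.of_le _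
  obtain ⟨μ, H⟩ := exists_scalar_projTensorSq (Ultrafilter.of atTop) hdK
    (fun a => (hdm a).mono_left hU) (fun a => (hdc a).mono_left hU) P h₀
  refine ⟨μ, fun s ε hε => ?_⟩
  obtain ⟨d, hdK, hi⟩ := H s (ε / 2) (half_pos hε)
  have hS : 0 ≤ ∑ φ ∈ s, ‖φ‖ := Finset.sum_nonneg fun _ _ => norm_nonneg _
  -- `‖φ‖ ≤ D / 2` on `s`, so an operator error `ε / D` costs at most `ε / 2` after composing with
  -- `φ`; and `D ≥ 1` keeps the cost excess below `ε`.
  set D : ℝ := 2 + 2 * ∑ φ ∈ s, ‖φ‖ with hD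
  have hDpos : 0 < D := by positivity
  obtain ⟨l, hl, hcost, h1, h2⟩ := exists_finiteRank_list_of_projTensorSq P
    (ContinuousLinearMap.id ℂ X - P) d (div_pos hε hDpos)
  have hφ (B : X →L[ℂ] X) (β : ℂ) (φ) (hs : φ ∈ s)
      (hB : ‖φ ∘L sandwichMap B d - β • φ‖ < ε / 2)
      (hl : ‖sandwichMap B d - pairSandwich B l‖ < ε / D) :
      ‖φ ∘L pairSandwich B l - β • φ‖ < ε := by
    have e : φ ∘L pairSandwich B l - β • φ = (φ ∘L sandwichMap B d - β • φ) -
        φ ∘L (sandwichMap B d - pairSandwich B l) := by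
      rw [ContinuousLinearMap.comp_sub]
      abel
    have hle : ‖φ‖ ≤ D / 2 := by
      have := Finset.single_le_sum (f := fun φ : X →L[ℂ] ℂ => ‖φ‖) (fun _ _ => norm_nonneg _) hs
      linarith
    have hb : ‖φ ∘L (sandwichMap B d - pairSandwich B l)‖ ≤ D / 2 * (ε / D) :=
      (ContinuousLinearMap.opNorm_comp_le _ _).trans
        (mul_le_mul hle hl.le (norm_nonneg _) (by positivity))
    have hb' : D / 2 * (ε / D) = ε / 2 := by field_simp
    rw [e]
    exact (norm_sub_le _ _).trans_lt (by linarith)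
  refine ⟨l, hl, ?_, fun φ hs => ⟨hφ _ _ φ hs (hi φ hs).1 h1, hφ _ _ φ hs (hi φ hs).2 h2⟩⟩
  have : ε / D ≤ ε := div_le_self hε.le (by linarith)
  linarith [hdK]

end Scalar

/-! ### Estimates for `γ` by compression -/

noncomputable section Factorization

theorem IsNormOn.sum_le {V : Type*} [AddCommGroup V] [Module ℂ V] {N : V → ℝ} (hN : IsNormOn N)
    {ι : Type*} (s : Finset ι) (v : ι → V) : N (∑ i ∈ s, v i) ≤ ∑ i ∈ s, N (v i) :=
  Finset.le_sum_of_subadditive N ((hN.eq_zero_iff 0).2 rfl).le hN.add_le s v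

section

variable {X Y Z : Type*} [NormedAddCommGroup X] [NormedSpace ℂ X]
  [NormedAddCommGroup Y] [NormedSpace ℂ Y] [NormedAddCommGroup Z] [NormedSpace ℂ Z]

theorem gammaNorm_comp_le (R : finiteRank Z Y) (S : finiteRank X Z) :
    gammaNorm Z (finiteRankComp X Z Y R S) ≤ ‖R‖ * ‖S‖ := by
  refine csInf_le ⟨0, ?_⟩ ⟨R, S, rfl, rfl⟩
  rintro _ ⟨R, S, -, rfl⟩
  positivity

/-- Rank one operators, as elements of `F(X, Y)`. -/
def rankOneOp (φ : X →L[ℂ] ℂ) (y : Y) : finiteRank X Y :=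
  ⟨φ.smulRight y, smulRight_mem_finiteRank φ y⟩

/-- Factor through the line spanned by `z`. With `z` and `f` fixed, rank one errors of small
operator norm are small for `γ` as well. -/
theorem gammaNorm_rankOneOp_le (φ : X →L[ℂ] ℂ) (y : Y) {z : Z} {f : Z →L[ℂ] ℂ} (hz : f z = 1) :
    gammaNorm Z (rankOneOp φ y) ≤ ‖f‖ * ‖z‖ * ‖y‖ * ‖φ‖ := by
  have h : finiteRankComp X Z Y (rankOneOp f y) (rankOneOp φ z) = rankOneOp φ y := by
    ext x
    simp [rankOneOp, hz]
  rw [← h]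
  refine (gammaNorm_comp_le _ _).trans (le_of_eq ?_)
  simp only [rankOneOp, Submodule.coe_norm,
    ContinuousLinearMap.norm_smulRight_apply]
  ring

theorem exists_eq_sum_smulRight (T : finiteRank X Y) :
    ∃ (n : ℕ) (φ : Fin n → X →L[ℂ] ℂ) (y : Fin n → Y),
      (T : X →L[ℂ] Y) = ∑ k, (φ k).smulRight (y k) := by
  obtain ⟨T, hT⟩ := T
  rw [mem_finiteRank] at hT
  let b := Module.finBasis ℂ (LinearMap.range T.toLinearMap)
  let T' : X →L[ℂ] LinearMap.range T.toLinearMap := T.codRestrict _ fun x => ⟨x, rfl⟩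
  refine ⟨_, fun k => LinearMap.toContinuousLinearMap (b.coord k) ∘L T', fun k => b k, ?_⟩
  ext x
  have := congrArg Subtype.val (b.sum_repr (T' x))
  rw [Submodule.coe_sum] at this
  rw [sum_apply]
  exact this.symm

end

variable {X Y Z : Type*} [NormedAddCommGroup X] [NormedSpace ℂ X]
  [NormedAddCommGroup Y] [NormedSpace ℂ Y] [NormedAddCommGroup Z] [NormedSpace ℂ Z]
  (iY : Y →L[ℂ] X) (pY : X →L[ℂ] Y) (iZ : Z →L[ℂ] X) (pZ : X →L[ℂ] Z)

/-- Each summand is `(T pZ a iY)(pY b iZ)`, a factorization through `Y`. Subadditivity of `γ` turns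
the sum of the costs into a bound for the whole operator. -/
theorem exists_compression_gammaNorm_le
    (hγ : IsNormOn (fun T : finiteRank Z Z => gammaNorm Y T)) (T : finiteRank Z Z)
    (l : List ((X →L[ℂ] X) × (X →L[ℂ] X)))
    (hl : ∀ p ∈ l, p.1 ∈ finiteRank X X ∧ p.2 ∈ finiteRank X X) :
    ∃ W : finiteRank Z Z,
      (W : Z →L[ℂ] Z) = (T : Z →L[ℂ] Z) ∘L pZ ∘L pairSandwich (iY ∘L pY) l ∘L iZ ∧
      gammaNorm Y W ≤ ‖iY‖ * ‖pY‖ * (‖iZ‖ * ‖pZ‖) * ‖T‖ * pairCost l := by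
  induction l with
  | nil => exact ⟨0, by ext; simp [pairSandwich], by simp [pairCost, (hγ.eq_zero_iff 0).2 rfl]⟩
  | cons p l ih =>
    obtain ⟨W, hW, hWγ⟩ := ih fun q hq => hl q (List.mem_cons_of_mem _ hq)
    let R : finiteRank Y Z := ⟨T.1 ∘L (pZ ∘L p.1 ∘L iY), comp_mem_finiteRank T.2 _⟩
    let S : finiteRank Z Y := ⟨pY ∘L p.2 ∘L iZ, by
      have h : FiniteDimensional ℂ (LinearMap.range p.2.toLinearMap) :=
        (hl p List.mem_cons_self).2
      refine Submodule.finiteDimensional_of_le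
        (S₂ := (LinearMap.range p.2.toLinearMap).map pY.toLinearMap) ?_
      rintro _ ⟨x, rfl⟩
      exact ⟨_, ⟨iZ x, rfl⟩, rfl⟩⟩
    refine ⟨finiteRankComp Z Y Z R S + W, ?_, ?_⟩
    · ext x
      simp [R, S, hW, pairSandwich]
    · have hR : ‖R‖ ≤ ‖T‖ * (‖pZ‖ * (‖p.1‖ * ‖iY‖)) :=
        (ContinuousLinearMap.opNorm_comp_le _ _).trans (mul_le_mul_of_nonneg_left
          ((ContinuousLinearMap.opNorm_comp_le _ _).trans (mul_le_mul_of_nonneg_left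
            (ContinuousLinearMap.opNorm_comp_le _ _) (norm_nonneg _))) (norm_nonneg _))
      have hS : ‖S‖ ≤ ‖pY‖ * (‖p.2‖ * ‖iZ‖) :=
        (ContinuousLinearMap.opNorm_comp_le _ _).trans (mul_le_mul_of_nonneg_left
          (ContinuousLinearMap.opNorm_comp_le _ _) (norm_nonneg _))
      have h1 := gammaNorm_comp_le R S
      have h2 := mul_le_mul hR hS (norm_nonneg _) (by positivity)
      have h3 := hγ.add_le (finiteRankComp Z Y Z R S) W
      have e : pairCost (p :: l) = ‖p.1‖ * ‖p.2‖ + pairCost l := by simp [pairCost]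
      rw [e]
      linarith

/-- The central estimate: `μ T` differs from a compression of controlled `γ` only by rank one terms,
one for each term of a representation of `T`, and these vanish as `ε → 0`. -/
theorem norm_mul_gammaNorm_le
    (hγ : IsNormOn (fun T : finiteRank Z Z => gammaNorm Y T)) (hpi : pZ ∘L iZ = .id ℂ Z)
    {y : Y} {f : Y →L[ℂ] ℂ} (hy : f y = 1) {K : ℝ} {μ : ℂ}
    (H : ∀ (s : Finset (X →L[ℂ] ℂ)) (ε : ℝ), 0 < ε →
      ∃ l : List ((X →L[ℂ] X) × (X →L[ℂ] X)),
        (∀ p ∈ l, p.1 ∈ finiteRank X X ∧ p.2 ∈ finiteRank X X) ∧ pairCost l < K + ε ∧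
        ∀ φ ∈ s, ‖φ ∘L pairSandwich (iY ∘L pY) l - μ • φ‖ < ε) (T : finiteRank Z Z) :
    ‖μ‖ * gammaNorm Y T ≤ ‖iY‖ * ‖pY‖ * (‖iZ‖ * ‖pZ‖) * ‖T‖ * K := by
  classical
  obtain ⟨n, ψ, z, hT⟩ := exists_eq_sum_smulRight T
  set C : ℝ := ‖iY‖ * ‖pY‖ * (‖iZ‖ * ‖pZ‖) * ‖T‖ with hC
  set D : ℝ := ∑ k, ‖f‖ * ‖y‖ * ‖z k‖ * ‖iZ‖ with hD
  have hbound {ε : ℝ} (hε : 0 < ε) : ‖μ‖ * gammaNorm Y T ≤ C * (K + ε) + ε * D := by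
    -- Only the functionals occurring in `T`, pulled back to `X`, need to be almost eigenvectors of
    -- the adjoint.
    obtain ⟨l, hl, hcost, hφ⟩ := H (Finset.univ.image fun k => ψ k ∘L pZ) ε hε
    obtain ⟨W, hW, hWγ⟩ := exists_compression_gammaNorm_le iY pY iZ pZ hγ T l hl
    set u := pairSandwich (iY ∘L pY) l with hu
    let χ (k : Fin n) : Z →L[ℂ] ℂ := ((ψ k ∘L pZ) ∘L u - μ • (ψ k ∘L pZ)) ∘L iZ
    have hdecomp : μ • T = W + (-1 : ℂ) • ∑ k, rankOneOp (χ k) (z k) := by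
      ext x
      have hx : pZ (iZ x) = x := DFunLike.congr_fun hpi x
      simp [hW, hT, rankOneOp, χ, hx, sub_smul, Finset.smul_sum, mul_smul]
    have hχ (k : Fin n) : ‖χ k‖ ≤ ε * ‖iZ‖ :=
      (ContinuousLinearMap.opNorm_comp_le _ _).trans (mul_le_mul_of_nonneg_right
        (hφ _ (Finset.mem_image_of_mem _ (Finset.mem_univ k))).le (norm_nonneg _))
    have hsum : gammaNorm Y (∑ k, rankOneOp (χ k) (z k)) ≤ ε * D := by
      refine (hγ.sum_le _ _).trans ?_
      rw [hD, Finset.mul_sum]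
      refine Finset.sum_le_sum fun k _ => (gammaNorm_rankOneOp_le (χ k) (z k) hy).trans ?_
      refine (mul_le_mul_of_nonneg_left (hχ k) (by positivity)).trans (le_of_eq (by ring))
    have h1 := hγ.smul μ T
    have h2 := hγ.add_le W ((-1 : ℂ) • ∑ k, rankOneOp (χ k) (z k))
    have h3 := hγ.smul (-1) (∑ k, rankOneOp (χ k) (z k))
    simp only [norm_neg, norm_one, one_mul] at h1 h2 h3
    rw [← hdecomp] at h2
    have h4 : C * pairCost l ≤ C * (K + ε) := mul_le_mul_of_nonneg_left hcost.le (by positivity)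
    linarith
  have hlim : Tendsto (fun ε : ℝ => C * (K + ε) + ε * D) (𝓝[>] 0) (𝓝 (C * K)) := by
    have : Continuous fun ε : ℝ => C * (K + ε) + ε * D := by fun_prop
    simpa using (this.tendsto 0).mono_left nhdsWithin_le_nhds
  exact ge_of_tendsto hlim (eventually_mem_nhdsWithin.mono fun ε hε => hbound hε)

/-- The infimum need not be attained, so the strict inequality is what supplies an actual
factorization. -/
theorem isMOpen_of_gammaNorm_lt
    (hγ : IsNormOn (fun T : finiteRank X Y => gammaNorm Z T)) {M : ℝ}
    (h : ∀ T : finiteRank X Y, T ≠ 0 → gammaNorm Z T < M * ‖T‖) :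
    IsMOpen (E := finiteRank Z Y) (F := finiteRank X Z) (G := finiteRank X Y)
      (finiteRankComp X Z Y) M := by
  intro T
  by_cases hT : T = 0
  · exact ⟨0, 0, by simp [hT], by simp [hT]⟩
  · have hne : gammaNorm Z T ≠ 0 := fun h0 => hT ((hγ.eq_zero_iff T).1 h0)
    -- The real infimum of the empty set is `0`, so `γ(T) ≠ 0` forces a factorization to exist.
    have hnonempty : {r : ℝ | ∃ (R : finiteRank Z Y) (S : finiteRank X Z),
        finiteRankComp X Z Y R S = T ∧ r = ‖R‖ * ‖S‖}.Nonempty := by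
      rw [Set.nonempty_iff_ne_empty]
      intro he
      exact hne (by rw [gammaNorm, he, Real.sInf_empty])
    obtain ⟨_, ⟨R, S, hRS, rfl⟩, hlt⟩ := exists_lt_of_csInf_lt hnonempty (h T hT)
    exact ⟨R, S, hRS, hlt.le⟩

end Factorization

/-! ### Assembling the constants -/

section Main

variable {X : Type*} [NormedAddCommGroup X] [NormedSpace ℂ X]

theorem norm_pairSandwich_add_le (P : X →L[ℂ] X) (l : List ((X →L[ℂ] X) × (X →L[ℂ] X))) :
    ‖pairSandwich P l + pairSandwich (ContinuousLinearMap.id ℂ X - P) l‖ ≤ pairCost l := by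
  induction l with
  | nil => simp [pairSandwich, pairCost]
  | cons p l ih =>
    have e : pairSandwich P (p :: l) + pairSandwich (ContinuousLinearMap.id ℂ X - P) (p :: l) =
        p.1 * p.2 + (pairSandwich P l + pairSandwich (ContinuousLinearMap.id ℂ X - P) l) := by
      ext x
      simp only [pairSandwich, List.map_cons, List.sum_cons, add_apply, sub_apply,
        mul_apply_eq_comp, map_sub, ContinuousLinearMap.id_apply]
      abel
    rw [e, pairCost, List.map_cons, List.sum_cons]
    exact (norm_add_le _ _).trans (add_le_add (norm_mul_le _ _) ih)

/-- Adding the two estimates gives `φ ≈ φ ∘ ∑ a b`, and `‖∑ a b‖` is at most the cost, so `‖φ‖ ≤ K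
‖φ‖` in the limit. -/
theorem one_le_of_scalar_list {K : ℝ} {P : X →L[ℂ] X} {μ : ℂ} {φ : X →L[ℂ] ℂ} (hφ : φ ≠ 0)
    (H : ∀ ε : ℝ, 0 < ε → ∃ l : List ((X →L[ℂ] X) × (X →L[ℂ] X)), pairCost l < K + ε ∧
      ‖φ ∘L pairSandwich P l - μ • φ‖ < ε ∧
      ‖φ ∘L pairSandwich (ContinuousLinearMap.id ℂ X - P) l - (1 - μ) • φ‖ < ε) : 1 ≤ K := by
  have hpos : 0 < ‖φ‖ := norm_pos_iff.2 hφ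
  have hbound {ε : ℝ} (hε : 0 < ε) : ‖φ‖ ≤ ‖φ‖ * (K + ε) + 2 * ε := by
    obtain ⟨l, hl, h1, h2⟩ := H ε hε
    set v := pairSandwich P l
    set w := pairSandwich (ContinuousLinearMap.id ℂ X - P) l
    have e : φ = φ ∘L (v + w) - ((φ ∘L v - μ • φ) + (φ ∘L w - (1 - μ) • φ)) := by
      ext x
      simp only [ContinuousLinearMap.comp_apply, add_apply, sub_apply, smul_apply, map_add,
        smul_eq_mul]
      ring
    have h3 : ‖φ ∘L (v + w)‖ ≤ ‖φ‖ * (K + ε) :=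
      (ContinuousLinearMap.opNorm_comp_le _ _).trans (mul_le_mul_of_nonneg_left
        ((norm_pairSandwich_add_le P l).trans hl.le) hpos.le)
    calc ‖φ‖ = ‖φ ∘L (v + w) - ((φ ∘L v - μ • φ) + (φ ∘L w - (1 - μ) • φ))‖ := by rw [← e]
      _ ≤ ‖φ ∘L (v + w)‖ + (‖φ ∘L v - μ • φ‖ + ‖φ ∘L w - (1 - μ) • φ‖) :=
        (norm_sub_le _ _).trans (add_le_add_right (norm_add_le _ _) _)
      _ ≤ ‖φ‖ * (K + ε) + 2 * ε := by linarith
  have hlim : Tendsto (fun ε : ℝ => ‖φ‖ * (K + ε) + 2 * ε) (𝓝[>] 0) (𝓝 (‖φ‖ * K)) := by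
    have : Continuous fun ε : ℝ => ‖φ‖ * (K + ε) + 2 * ε := by fun_prop
    simpa using (this.tendsto 0).mono_left nhdsWithin_le_nhds
  have := ge_of_tendsto hlim (eventually_mem_nhdsWithin.mono fun ε hε => hbound hε)
  exact (le_mul_iff_one_le_right hpos).1 this

theorem one_le_norm_of_projection {P : X →L[ℂ] X} (hP : P ∘L P = P) (h : P ≠ 0) : 1 ≤ ‖P‖ := by
  have h1 : ‖P‖ ≤ ‖P‖ * ‖P‖ := by simpa [hP] using P.opNorm_comp_le P
  exact (le_mul_iff_one_le_right (norm_pos_iff.2 h)).1 h1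

theorem exists_apply_eq_one {Y : Type*} [NormedAddCommGroup Y] [NormedSpace ℂ Y]
    (hY : ¬ FiniteDimensional ℂ Y) : ∃ (y : Y) (f : Y →L[ℂ] ℂ), f y = 1 := by
  obtain ⟨y, hy⟩ : ∃ y : Y, y ≠ 0 := by
    by_contra! h
    have : Subsingleton Y := ⟨fun a b => (h a).trans (h b).symm⟩
    exact hY inferInstance
  obtain ⟨f, hf⟩ := SeparatingDual.exists_eq_one (R := ℂ) hy
  exact ⟨y, f, hf⟩

/-- The range of a projection is its fixed point set, which is closed. -/
theorem completeSpace_rg [CompleteSpace X] {P : X →L[ℂ] X} (hP : P ∘L P = P) :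
    CompleteSpace (rg P) := by
  have h : (rg P : Set X) = {x | P x = x} := by
    ext x
    refine ⟨?_, fun hx => ⟨x, hx⟩⟩
    rintro ⟨y, rfl⟩
    exact DFunLike.congr_fun hP y
  have : IsClosed (rg P : Set X) := by
    rw [h]
    exact isClosed_eq P.continuous continuous_id
  exact this.completeSpace_coe

/-- If the operators `∑ a P b` with `∑ ‖a‖ ‖b‖` close to `K` approximate a scalar `μ` with
`1 / 2 ≤ ‖μ‖`, then operators on `rg Q` factor through `rg P` with control of the norms. -/
theorem isMOpen_of_scalar_list [CompleteSpace X] {P Q : X →L[ℂ] X} (hQ : Q ∘L Q = Q)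
    (hY : HasFactorizationNormProperty (rg P)) {K M : ℝ} {μ : ℂ}
    (hμ : 1 / 2 ≤ ‖μ‖)
    (H : ∀ (s : Finset (X →L[ℂ] ℂ)) (ε : ℝ), 0 < ε →
      ∃ l : List ((X →L[ℂ] X) × (X →L[ℂ] X)),
        (∀ p ∈ l, p.1 ∈ finiteRank X X ∧ p.2 ∈ finiteRank X X) ∧ pairCost l < K + ε ∧
        ∀ φ ∈ s, ‖φ ∘L pairSandwich P l - μ • φ‖ < ε) (hK : 0 ≤ K)
    (hM : 2 * (‖P‖ * ‖Q‖ * K) < M) :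
    IsMOpen (E := finiteRank (rg P) (rg Q)) (F := finiteRank (rg Q) (rg P))
      (G := finiteRank (rg Q) (rg Q)) (finiteRankComp (rg Q) (rg P) (rg Q)) M := by
  have := completeSpace_rg hQ
  have hγ := hY.isNormOn (rg Q) (rg Q)
  obtain ⟨y, f, hf⟩ := exists_apply_eq_one hY.infinite_dimensional
  let pY : X →L[ℂ] rg P := P.codRestrict (rg P) fun x => ⟨x, rfl⟩
  let pZ : X →L[ℂ] rg Q := Q.codRestrict (rg Q) fun x => ⟨x, rfl⟩
  have hpi : pZ ∘L (rg Q).subtypeL = .id ℂ (rg Q) := by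
    ext ⟨_, x, rfl⟩
    exact DFunLike.congr_fun hQ x
  have hpY : ‖pY‖ ≤ ‖P‖ := pY.opNorm_le_bound (norm_nonneg _) fun x => P.le_opNorm x
  have hpZ : ‖pZ‖ ≤ ‖Q‖ := pZ.opNorm_le_bound (norm_nonneg _) fun x => Q.le_opNorm x
  have hC : ‖(rg P).subtypeL‖ * ‖pY‖ * (‖(rg Q).subtypeL‖ * ‖pZ‖) ≤ ‖P‖ * ‖Q‖ := by
    have h1 := mul_le_mul (rg P).norm_subtypeL_le hpY (norm_nonneg pY) zero_le_one
    have h2 := mul_le_mul (rg Q).norm_subtypeL_le hpZ (norm_nonneg pZ) zero_le_one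
    rw [one_mul] at h1 h2
    exact mul_le_mul h1 h2 (by positivity) (norm_nonneg _)
  refine isMOpen_of_gammaNorm_lt hγ fun T hT => ?_
  have hTpos : 0 < ‖T‖ := norm_pos_iff.2 hT
  have h := norm_mul_gammaNorm_le (rg P).subtypeL pY (rg Q).subtypeL pZ hγ hpi hf H T
  have h1 : 1 / 2 * gammaNorm (rg P) T ≤ ‖μ‖ * gammaNorm (rg P) T :=
    mul_le_mul_of_nonneg_right hμ (hγ.nonneg T)
  have h2 := mul_le_mul_of_nonneg_right (mul_le_mul_of_nonneg_right hC hTpos.le) hK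
  have h3 := mul_lt_mul_of_pos_right hM hTpos
  linarith

end Main

theorem mainTheorem11 {X : Type*} [NormedAddCommGroup X] [NormedSpace ℂ X] [CompleteSpace X]
    (hX : ¬ FiniteDimensional ℂ X) (K : ℝ) (hK : IsKAmenable (approximableAlgebra X) K)
    (P : X →L[ℂ] X) (hP : P ∘L P = P)
    (hY : HasFactorizationNormProperty (rg P))
    (hZ : HasFactorizationNormProperty (rg (ContinuousLinearMap.id ℂ X - P))) :
    ∃ κ M : ℝ, 0 ≤ κ ∧
      κ ≤ 4 * K ^ 2 * ‖P‖ * ‖ContinuousLinearMap.id ℂ X - P‖ *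
        max (‖P‖ ^ 4) (‖ContinuousLinearMap.id ℂ X - P‖ ^ 4) ∧
      M ≤ κ ^ 2 * K ^ 2 * ‖P‖ * ‖ContinuousLinearMap.id ℂ X - P‖ ∧
      (IsMOpen (finiteRankComp (rg P) (rg (ContinuousLinearMap.id ℂ X - P)) (rg P)) M ∨
        IsMOpen (finiteRankComp (rg (ContinuousLinearMap.id ℂ X - P)) (rg P)
          (rg (ContinuousLinearMap.id ℂ X - P))) M) := by
  obtain ⟨x₀, φ₀, h₀⟩ := exists_apply_eq_one hX
  obtain ⟨μ, H⟩ := exists_scalar_list hK P h₀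
  set Q : X →L[ℂ] X := ContinuousLinearMap.id ℂ X - P with hQdef
  have hQ : Q ∘L Q = Q := by
    simp [hQdef, ContinuousLinearMap.comp_sub, ContinuousLinearMap.sub_comp, hP]
  have hK1 : 1 ≤ K := by
    refine one_le_of_scalar_list (P := P) (μ := μ) (φ := φ₀) (by rintro rfl; simp at h₀) fun ε hε => ?_
    obtain ⟨l, -, hl, h⟩ := H {φ₀} ε hε
    exact ⟨l, hl, h φ₀ (Finset.mem_singleton_self _)⟩
  have hne {R : X →L[ℂ] X} (hR : HasFactorizationNormProperty (rg R)) : R ≠ 0 := by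
    rintro rfl
    exact hR.infinite_dimensional (finiteRank X X).zero_mem
  have hP1 := one_le_norm_of_projection hP (hne hY)
  have hQ1 := one_le_norm_of_projection hQ (hne hZ)
  -- `κ` and `M` are given their largest allowed values. The argument needs only `M > 2 K ‖P‖ ‖Q‖`,
  -- for which `κ ≥ 4` suffices.
  set κ : ℝ := 4 * K ^ 2 * ‖P‖ * ‖Q‖ * max (‖P‖ ^ 4) (‖Q‖ ^ 4) with hκ
  have hκ4 : 4 ≤ κ := by
    have h1 : 1 ≤ max (‖P‖ ^ 4) (‖Q‖ ^ 4) := le_max_of_le_left (one_le_pow₀ hP1)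
    have h2 : 1 ≤ K ^ 2 * ‖P‖ * ‖Q‖ * max (‖P‖ ^ 4) (‖Q‖ ^ 4) :=
      one_le_mul_of_one_le_of_one_le (one_le_mul_of_one_le_of_one_le
        (one_le_mul_of_one_le_of_one_le (one_le_pow₀ hK1) hP1) hQ1) h1
    linarith
  have hPQ : 0 < ‖P‖ * ‖Q‖ := by positivity
  have hM : 2 * (‖P‖ * ‖Q‖ * K) < κ ^ 2 * K ^ 2 * ‖P‖ * ‖Q‖ := by
    have h1 : 2 * K < κ ^ 2 * K ^ 2 := by
      have h3 : 16 ≤ κ ^ 2 := by nlinarith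
      have h4 : K ≤ K ^ 2 := le_self_pow₀ hK1 two_ne_zero
      have h5 : 16 * K ≤ κ ^ 2 * K ^ 2 := mul_le_mul h3 h4 (by linarith) (by positivity)
      linarith
    have h2 := mul_lt_mul_of_pos_right h1 hPQ
    linarith
  refine ⟨κ, _, by linarith, le_rfl, le_rfl, ?_⟩
  -- A large `μ` lets operators on `rg Q` factor through `rg P`; a large `1 - μ` does the reverse.
  rcases le_total (1 / 2) ‖μ‖ with hμ | hμ
  · refine Or.inr (isMOpen_of_scalar_list (K := K) hQ hY hμ (fun s ε hε => ?_) (by linarith) hM)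
    obtain ⟨l, hl, hc, h⟩ := H s ε hε
    exact ⟨l, hl, hc, fun φ hφ => (h φ hφ).1⟩
  · have hν : 1 / 2 ≤ ‖1 - μ‖ := by
      have := norm_sub_norm_le (1 : ℂ) μ
      rw [norm_one] at this
      linarith
    refine Or.inl (isMOpen_of_scalar_list (K := K) hP hZ hν (fun s ε hε => ?_) (by linarith) ?_)
    · obtain ⟨l, hl, hc, h⟩ := H s ε hε
      exact ⟨l, hl, hc, fun φ hφ => (h φ hφ).2⟩
    · rwa [mul_comm ‖Q‖]
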